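/- Let $n\ge 0$ be an integer and let $u:\{-n,\dots,n\}\to\mathbb{R}$ be symmetric ($u(-k)=u(k)$ for all $k$) with $\sum_{k=-n}^n u(k)=1$. For $f\in\ell^2(\mathbb{Z})$ (real- or complex-valued) put $(f*u)(j)=\sum_{k=-n}^n f(j-k)u(k)$ and $(\nabla g)(k)=g(k+1)-g(k)$. Then $f\mapsto\nabla(f*u)$ maps $\ell^2(\mathbb{Z})$ boundedly into itself, and $$\sup_{0\ne f\in\ell^2(\mathbb{Z})}\frac{\|\nabla(f*u)\|_{\ell^2(\mathbb{Z})}}{\|f\|_{\ell^2(\mathbb{Z})}}\ \ge\ \frac{2}{2n+1},$$ with equality if and only if $u$ is the constant function $u(k)=1/(2n+1)$. This holds both when the supremum is taken over real-valued $f$ and when it is taken over complex-valued $f$. -/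

import Mathlib

open scoped ENNReal

namespace SmoothAveraging

/-- The window `{-n, …, n}` of integers. -/
abbrev Window (n : ℕ) : Type := ↥(Finset.Icc (-(n : ℤ)) (n : ℤ))

/-- A function on `{-n, …, n}` is symmetric (even) if `u (-k) = u k` for all `k`. -/
def IsSymmetric {n : ℕ} (u : Window n → ℝ) : Prop :=
  ∀ j k : Window n, (j : ℤ) = -(k : ℤ) → u j = u k

/-- The Hilbert space `ℓ²(ℤ)` with scalars `𝕜` (real or complex). -/
abbrev EllTwo (𝕜 : Type*) [RCLike 𝕜] : Type _ := lp (fun _ : ℤ => 𝕜) 2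

/-- The convolution `(f * u)(j) = ∑ k, f (j - k) u k`, the sum running over `{-n, …, n}`. -/
noncomputable def conv {𝕜 : Type*} [RCLike 𝕜] {n : ℕ} (f : ℤ → 𝕜) (u : Window n → ℝ) : ℤ → 𝕜 :=
  fun j => ∑ k : Window n, f (j - (k : ℤ)) * (u k : 𝕜)

/-- The discrete derivative `(∇ f)(k) = f (k + 1) - f k`. -/
def grad {𝕜 : Type*} [RCLike 𝕜] (f : ℤ → 𝕜) : ℤ → 𝕜 :=
  fun k => f (k + 1) - f k

theorem memℓp_translate {𝕜 : Type*} [RCLike 𝕜] {f : ℤ → 𝕜}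
    (hf : Memℓp f 2) (m : ℤ) : Memℓp (fun k => f (k + m)) 2 := by
  have h2 : 0 < (2 : ℝ≥0∞).toReal := by norm_num
  rw [memℓp_gen_iff h2] at hf ⊢
  exact (Equiv.addRight m).summable_iff.mpr hf

theorem memℓp_conv {𝕜 : Type*} [RCLike 𝕜] {n : ℕ} {f : ℤ → 𝕜}
    (hf : Memℓp f 2) (u : Window n → ℝ) : Memℓp (conv f u) 2 := by
  refine Memℓp.finsetSum Finset.univ
    (f := fun (k : Window n) (j : ℤ) => f (j - (k : ℤ)) * (u k : 𝕜)) ?_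
  intro k _
  have h := (memℓp_translate hf (-(k : ℤ))).const_mul (u k : 𝕜)
  simpa only [mul_comm, sub_eq_add_neg] using h

theorem memℓp_grad {𝕜 : Type*} [RCLike 𝕜] {f : ℤ → 𝕜}
    (hf : Memℓp f 2) : Memℓp (grad f) 2 :=
  (memℓp_translate hf 1).sub hf

/-- The map `f ↦ ∇ (f * u)` from `ℓ²(ℤ)` to `ℓ²(ℤ)`. -/
noncomputable def gradConv {𝕜 : Type*} [RCLike 𝕜] {n : ℕ} (u : Window n → ℝ) (f : EllTwo 𝕜) : EllTwo 𝕜 :=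
  ⟨grad (conv (f : ℤ → 𝕜) u), memℓp_grad (memℓp_conv (lp.memℓp f) u)⟩

/-- The set of ratios `‖∇ (f * u)‖ / ‖f‖` over all nonzero `f` in `ℓ²(ℤ)`. -/
def ratios (𝕜 : Type*) [RCLike 𝕜] {n : ℕ} (u : Window n → ℝ) : Set ℝ :=
  {r | ∃ f : EllTwo 𝕜, f ≠ 0 ∧ r = ‖gradConv u f‖ / ‖f‖}

end SmoothAveraging

namespace SmoothAveraging

open Polynomial

/-! In Fourier variables the operator multiplies by a function of modulus `|2 sin (x/2) S(x)|`,
where `S = symbol u` is a polynomial of degree at most `n` in `cos x` with value 1 at `x = 0`. For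
constant `u` this is `2/(2n+1) * |sin ((2n+1)x/2)|`, which equioscillates. If the modulus of some
`u` stays below `2/(2n+1)`, subtracting the constant kernel leaves a polynomial of degree at most
`n` that weakly alternates at `n + 2` nodes, hence vanishes (`eq_const_of_symbol_le`). So any norm
at most `2/(2n+1)` forces the constant kernel, which gives both the bound and the equality case.
Only "symbol ≤ norm" is needed in general (`abs_symbol_le_sSup`); real truncated cosines prove it
over both fields. -/

/-- A real polynomial of degree less than `m` whose values at `m + 1` decreasing nodes weakly
alternate in sign is zero. -/
theorem eq_zero_of_weakly_alternating {m : ℕ} {v : ℕ → ℝ}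
    (hv : ∀ i j, i < j → j ≤ m → v j < v i) {P : ℝ[X]} (hP : P.degree < m)
    (hsign : ∀ i ≤ m, 0 ≤ (-1) ^ i * P.eval (v i)) : P = 0 := by
  have hinj : Set.InjOn v (Finset.range (m + 1) : Finset ℕ) := by
    intro i hi j hj hij
    simp only [Finset.coe_range, Set.mem_Iio] at hi hj
    rcases lt_trichotomy i j with h | h | h
    · exact absurd hij (hv i j h (by omega)).ne'
    · exact h
    · exact absurd hij (hv j i h (by omega)).ne
  have hcard : (Finset.range (m + 1)).card = m + 1 := Finset.card_range _
  have hdeg : P.degree < (Finset.range (m + 1)).card := by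
    rw [hcard]
    exact hP.trans (by exact_mod_cast Nat.lt_succ_self m)
  have hpos : ∀ i ≤ m,
      0 < (-1) ^ i * ∏ j ∈ (Finset.range (m + 1)).erase i, (v i - v j) := by
    intro i hi
    have h₁ : 0 < ∏ j ∈ Finset.range i, ((-1) * (v i - v j)) :=
      Finset.prod_pos fun j hj => mul_pos_of_neg_of_neg neg_one_lt_zero <| sub_neg.mpr <|
        hv j i (Finset.mem_range.mp hj) hi
    rw [Finset.prod_mul_distrib, Finset.prod_const, Finset.card_range] at h₁
    have h₂ : 0 < ∏ j ∈ Finset.Ioc i m, (v i - v j) :=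
      Finset.prod_pos fun j hj => sub_pos.mpr <|
        hv i j (Finset.mem_Ioc.mp hj).1 (Finset.mem_Ioc.mp hj).2
    have hunion : (Finset.range (m + 1)).erase i = Finset.range i ∪ Finset.Ioc i m := by grind
    have hdisj : Disjoint (Finset.range i) (Finset.Ioc i m) := by
      grind [Finset.disjoint_iff_ne]
    rw [hunion, Finset.prod_union hdisj, ← mul_assoc]
    exact mul_pos h₁ h₂
  -- The interpolation formula for the coefficient of `X ^ m`, which is zero here. The nodal
  -- products alternate like the values, so every summand is nonnegative and must vanish.
  have hsum := Lagrange.coeff_eq_sum hinj hdeg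
  rw [hcard, Nat.add_sub_cancel, coeff_eq_zero_of_degree_lt hP] at hsum
  have hfrac : ∀ i, P.eval (v i) / ∏ j ∈ (Finset.range (m + 1)).erase i, (v i - v j) =
      ((-1) ^ i * P.eval (v i)) /
        ((-1) ^ i * ∏ j ∈ (Finset.range (m + 1)).erase i, (v i - v j)) := fun i =>
    (mul_div_mul_left _ _ (pow_ne_zero i (by norm_num))).symm
  have hnonneg : ∀ i ∈ Finset.range (m + 1),
      0 ≤ P.eval (v i) / ∏ j ∈ (Finset.range (m + 1)).erase i, (v i - v j) := by
    intro i hi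
    have hi' : i ≤ m := Nat.lt_succ_iff.mp (Finset.mem_range.mp hi)
    rw [hfrac]
    exact div_nonneg (hsign i hi') (hpos i hi').le
  have hzero := (Finset.sum_eq_zero_iff_of_nonneg hnonneg).mp hsum.symm
  refine Polynomial.eq_zero_of_degree_lt_of_eval_index_eq_zero _ hinj hdeg fun i hi => ?_
  have hi' : i ≤ m := Nat.lt_succ_iff.mp (Finset.mem_range.mp hi)
  have h := hzero i hi
  rw [div_eq_zero_iff] at h
  exact h.resolve_right (right_ne_zero_of_mul (hpos i hi').ne')

/-! ### Symmetric kernels as Chebyshev sums -/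

variable {n : ℕ}

/-- The polynomial `∑ k, u k * T k`, where `T k` is the `k`-th Chebyshev polynomial. -/
noncomputable def chebyshevSum (u : Window n → ℝ) : ℝ[X] :=
  ∑ k : Window n, C (u k) * Chebyshev.T ℝ (k : ℤ)

/-- The Fourier symbol `∑ k, u k * cos (k x)` of a symmetric kernel. -/
noncomputable def symbol (u : Window n → ℝ) (x : ℝ) : ℝ :=
  ∑ k : Window n, u k * Real.cos ((k : ℤ) * x)

theorem eval_chebyshevSum_cos (u : Window n → ℝ) (x : ℝ) :
    (chebyshevSum u).eval (Real.cos x) = symbol u x := by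
  simp [chebyshevSum, symbol, eval_finsetSum, Chebyshev.T_real_cos]

theorem eval_chebyshevSum_one (u : Window n → ℝ) :
    (chebyshevSum u).eval 1 = ∑ k, u k := by
  simp [chebyshevSum, eval_finsetSum]

theorem natAbs_le_of_window (k : Window n) : (k : ℤ).natAbs ≤ n := by
  have := Finset.mem_Icc.mp k.2
  omega

theorem degree_chebyshevSum_lt (u : Window n → ℝ) :
    (chebyshevSum u).degree < ((n + 1 : ℕ) : WithBot ℕ) := by
  refine degree_lt_iff_coeff_zero _ _ |>.mpr fun m hm => ?_
  rw [chebyshevSum, finsetSum_coeff]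
  refine Finset.sum_eq_zero fun k _ => ?_
  rw [coeff_C_mul, coeff_eq_zero_of_natDegree_lt, mul_zero]
  rw [Chebyshev.natDegree_T]
  have := natAbs_le_of_window k
  omega

theorem eq_zero_of_chebyshevSum_eq_zero {u : Window n → ℝ} (hu : IsSymmetric u)
    (h : chebyshevSum u = 0) (k : Window n) : u k = 0 := by
  classical
  by_contra hk
  obtain ⟨m, hm, hmax⟩ := Finset.exists_max_image
    (Finset.univ.filter fun j : Window n => u j ≠ 0) (fun j => (j : ℤ).natAbs) ⟨k, by simp [hk]⟩
  simp only [Finset.mem_filter, Finset.mem_univ, true_and] at hm hmax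
  -- By symmetry the terms at `m` and `-m` cannot cancel; the extra factor `u m` makes both
  -- positive.
  have hcoeff : ∑ j : Window n, u m * (u j * (Chebyshev.T ℝ (j : ℤ)).coeff (m : ℤ).natAbs) = 0 := by
    rw [← Finset.mul_sum]
    have := congrArg (fun P : ℝ[X] => P.coeff (m : ℤ).natAbs) h
    simp only [chebyshevSum, finsetSum_coeff, coeff_C_mul, coeff_zero] at this
    rw [this, mul_zero]
  have hlead : ∀ j : Window n, (j : ℤ).natAbs = (m : ℤ).natAbs →
      0 < u m * (u j * (Chebyshev.T ℝ (j : ℤ)).coeff (m : ℤ).natAbs) := by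
    intro j hj
    have huj : u j = u m := by
      rcases Int.natAbs_eq_natAbs_iff.mp hj with h | h
      · rw [Subtype.ext h]
      · exact hu j m h
    rw [← hj, ← Chebyshev.natDegree_T ℝ (j : ℤ), coeff_natDegree, Chebyshev.leadingCoeff_T, huj,
      ← mul_assoc]
    exact mul_pos (mul_self_pos.mpr hm) (by positivity)
  refine (Finset.sum_pos' (fun j _ => ?_) ⟨m, Finset.mem_univ m, hlead m rfl⟩).ne' hcoeff
  rcases lt_trichotomy (j : ℤ).natAbs (m : ℤ).natAbs with hj | hj | hj
  · rw [coeff_eq_zero_of_natDegree_lt (by rwa [Chebyshev.natDegree_T])]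
    simp
  · exact (hlead j hj).le
  · have : u j = 0 := by
      by_contra hne
      exact absurd (hmax j hne) (by omega)
    simp [this]

/-! ### Dirichlet kernel and extremality -/

theorem sum_window {M : Type*} [AddCommMonoid M] (g : ℤ → M) :
    ∑ k : Window n, g k = ∑ i ∈ Finset.range (2 * n + 1), g ((i : ℤ) - n) := by
  rw [Finset.sum_coe_sort (Finset.Icc (-(n : ℤ)) n) g]
  refine (Finset.sum_bij (fun (i : ℕ) _ => (i : ℤ) - n) ?_ ?_ ?_ ?_).symm
  · intro i hi
    simp only [Finset.mem_range, Finset.mem_Icc] at hi ⊢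
    omega
  · intro i _ j _ h
    simpa using h
  · intro b hb
    rw [Finset.mem_Icc] at hb
    refine ⟨(b + n).toNat, ?_, ?_⟩
    · rw [Finset.mem_range]
      omega
    · omega
  · intro i _
    rfl

theorem sum_const_window (c : ℝ) : ∑ _k : Window n, c = (2 * n + 1) * c := by
  rw [sum_window (n := n) fun _ => c]
  simp

/-- The closed form of the Dirichlet kernel. -/
theorem two_sin_half_mul_sum_cos (x : ℝ) :
    2 * Real.sin (x / 2) * ∑ k : Window n, Real.cos ((k : ℤ) * x) =
      2 * Real.sin ((2 * n + 1) * x / 2) := by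
  rw [sum_window (n := n) fun k : ℤ => Real.cos (k * x), Finset.mul_sum]
  have hterm : ∀ i : ℕ, 2 * Real.sin (x / 2) * Real.cos ((((i : ℤ) - n : ℤ) : ℝ) * x) =
      Real.sin ((((i + 1 : ℕ) : ℝ) - n) * x - x / 2) - Real.sin (((i : ℝ) - n) * x - x / 2) := by
    intro i
    rw [Real.sin_sub_sin]
    push_cast
    ring_nf
  rw [Finset.sum_congr rfl fun i _ => hterm i,
    Finset.sum_range_sub (fun i : ℕ => Real.sin (((i : ℝ) - n) * x - x / 2))]
  have h1 : (((2 * n + 1 : ℕ) : ℝ) - n) * x - x / 2 = (2 * n + 1) * x / 2 := by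
    push_cast; ring
  have h2 : (((0 : ℕ) : ℝ) - n) * x - x / 2 = -((2 * n + 1) * x / 2) := by
    push_cast; ring
  rw [h1, h2, Real.sin_neg]
  ring

/-- If the symbol of `f ↦ ∇ (f * u)` is bounded by `2 / (2 n + 1)`, then `u` is constant. -/
theorem eq_const_of_symbol_le {u : Window n → ℝ} (hu : IsSymmetric u) (hsum : ∑ k, u k = 1)
    (hbound : ∀ x, |2 * Real.sin (x / 2) * symbol u x| ≤ 2 / (2 * (n : ℝ) + 1)) (k : Window n) :
    u k = 1 / (2 * (n : ℝ) + 1) := by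
  set c : ℝ := 1 / (2 * (n : ℝ) + 1) with hc
  have hN : (0 : ℝ) < 2 * n + 1 := by positivity
  let w : Window n → ℝ := fun k => u k - c
  have hw : IsSymmetric w := fun i j hij => by simp only [w, hu i j hij]
  have hsymb : ∀ x, 2 * Real.sin (x / 2) * symbol w x =
      2 * Real.sin (x / 2) * symbol u x - 2 * c * Real.sin ((2 * n + 1) * x / 2) := by
    intro x
    have : symbol w x = symbol u x - c * ∑ k : Window n, Real.cos ((k : ℤ) * x) := by
      simp only [symbol, w, sub_mul, Finset.sum_sub_distrib, Finset.mul_sum]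
    rw [this]
    linear_combination -c * two_sin_half_mul_sum_cos (n := n) x
  -- For `i ≥ 1` these are the points of `(0, π]` where `sin ((2n+1)x/2) = ±1`, ending at `π`. The
  -- extra node 0 uses the normalisation: `w` sums to zero.
  let θ : ℕ → ℝ := fun i => if i = 0 then 0 else (2 * i - 1) * Real.pi / (2 * n + 1)
  have hθ : ∀ i : ℕ, i ≠ 0 → θ i = (2 * i - 1) * Real.pi / (2 * n + 1) := fun i hi => by
    simp [θ, hi]
  have hone : ∀ i : ℕ, i ≠ 0 → (1 : ℝ) ≤ i := fun i hi => by
    exact_mod_cast Nat.one_le_iff_ne_zero.mpr hi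
  have hθ_pos : ∀ i : ℕ, i ≠ 0 → 0 < θ i := fun i hi => by
    rw [hθ i hi]
    have := hone i hi
    have := Real.pi_pos
    apply div_pos (mul_pos (by linarith) this) hN
  have hθ_le : ∀ i ≤ n + 1, θ i ≤ Real.pi := by
    intro i hi
    by_cases h0 : i = 0
    · simp [θ, h0, Real.pi_pos.le]
    · rw [hθ i h0, div_le_iff₀ hN]
      have : (i : ℝ) ≤ n + 1 := by exact_mod_cast hi
      nlinarith [Real.pi_pos]
  have hθ_lt : ∀ i j, i < j → θ i < θ j := by
    intro i j hij
    by_cases h0 : i = 0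
    · have := hθ_pos j (by omega)
      simpa [h0, θ] using this
    · rw [hθ i h0, hθ j (by omega)]
      have : (i : ℝ) < j := by exact_mod_cast hij
      gcongr
  have hθ_nonneg : ∀ i, 0 ≤ θ i := fun i => by
    by_cases h0 : i = 0
    · simp [h0, θ]
    · exact (hθ_pos i h0).le
  have hzero : chebyshevSum w = 0 := by
    refine eq_zero_of_weakly_alternating (m := n + 1) (v := fun i => Real.cos (θ i)) ?_
      (degree_chebyshevSum_lt w) ?_
    · intro i j hij hj
      exact Real.cos_lt_cos_of_nonneg_of_le_pi (hθ_nonneg i) (hθ_le j hj) (hθ_lt i j hij)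
    · intro i hi
      rw [eval_chebyshevSum_cos]
      by_cases h0 : i = 0
      · have : symbol w 0 = 0 := by
          rw [← eval_chebyshevSum_cos, Real.cos_zero, eval_chebyshevSum_one]
          simp only [w, Finset.sum_sub_distrib, hsum, sum_const_window, hc]
          field_simp
          ring
        simp [θ, h0, this]
      · have hs : 0 < 2 * Real.sin (θ i / 2) := by
          have := Real.sin_pos_of_pos_of_lt_pi (x := θ i / 2) (by linarith [hθ_pos i h0])
            (by linarith [hθ_le i hi, Real.pi_pos])
          linarith
        have hsin : Real.sin ((2 * n + 1) * θ i / 2) = -(-1) ^ i := by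
          have : (2 * (n : ℝ) + 1) * θ i / 2 = i * Real.pi - Real.pi / 2 := by
            rw [hθ i h0]
            field_simp
          rw [this, Real.sin_sub_pi_div_two, Real.cos_nat_mul_pi]
        refine nonneg_of_mul_nonneg_right (a := 2 * Real.sin (θ i / 2)) ?_ hs
        have heq : 2 * Real.sin (θ i / 2) * ((-1) ^ i * symbol w (θ i)) =
            (-1) ^ i * (2 * Real.sin (θ i / 2) * symbol u (θ i)) + 2 * c := by
          have hsq : ((-1 : ℝ) ^ i) * (-1) ^ i = 1 := by
            rw [← mul_pow]; norm_num
          have := hsymb (θ i)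
          rw [hsin] at this
          linear_combination (-1) ^ i * this + 2 * c * hsq
        rw [heq]
        have hb := hbound (θ i)
        have habs : |(-1) ^ i * (2 * Real.sin (θ i / 2) * symbol u (θ i))| ≤ 2 * c := by
          rw [abs_mul, abs_neg_one_pow, one_mul, hc]
          convert hb using 1
          ring
        linarith [neg_le_of_abs_le habs]
  have := eq_zero_of_chebyshevSum_eq_zero hw hzero k
  simp only [w] at this
  linarith

theorem sum_mul_sin_eq_zero {u : Window n → ℝ} (hu : IsSymmetric u) (x : ℝ) :
    ∑ k : Window n, u k * Real.sin ((k : ℤ) * x) = 0 := by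
  let e : Window n → Window n := fun k => ⟨-(k : ℤ), by
    have := Finset.mem_Icc.mp k.2
    rw [Finset.mem_Icc]
    omega⟩
  have he : Function.Involutive e := fun k => Subtype.ext (neg_neg _)
  let σ : Equiv.Perm (Window n) := Function.Involutive.toPerm e he
  have h := Equiv.sum_comp σ fun k : Window n => u k * Real.sin ((k : ℤ) * x)
  have h' : ∀ k : Window n, u (σ k) * Real.sin ((σ k : ℤ) * x) =
      -(u k * Real.sin ((k : ℤ) * x)) := by
    intro k
    have h1 : u (σ k) = u k := hu _ _ rfl
    have h2 : (σ k : ℤ) = -(k : ℤ) := rfl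
    rw [h1, h2]
    push_cast
    rw [neg_mul, Real.sin_neg, mul_neg]
  rw [Finset.sum_congr rfl fun k _ => h' k, Finset.sum_neg_distrib] at h
  linarith

/-- Cosines of every phase are eigenfunctions of convolution with `u`, since the sine part is odd in
`k` and drops out. -/
theorem sum_cos_sub_mul {u : Window n → ℝ} (hu : IsSymmetric u) (x y : ℝ) :
    ∑ k : Window n, Real.cos (y - (k : ℤ) * x) * u k = symbol u x * Real.cos y := by
  calc ∑ k : Window n, Real.cos (y - (k : ℤ) * x) * u k
      = ∑ k : Window n, (Real.cos y * (u k * Real.cos ((k : ℤ) * x)) +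
          Real.sin y * (u k * Real.sin ((k : ℤ) * x))) :=
        Finset.sum_congr rfl fun k _ => by rw [Real.cos_sub]; ring
    _ = symbol u x * Real.cos y := by
        rw [Finset.sum_add_distrib, ← Finset.mul_sum, ← Finset.mul_sum, sum_mul_sin_eq_zero hu,
          symbol]
        ring

/-! ### Norm bounds on `ℓ²(ℤ)` -/

section Operator

variable {𝕜 : Type*} [RCLike 𝕜]

theorem two_toReal_pos : 0 < (2 : ℝ≥0∞).toReal := by norm_num

theorem norm_sq_eq_tsum (f : EllTwo 𝕜) : ‖f‖ ^ 2 = ∑' j, ‖f j‖ ^ 2 := by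
  simpa using lp.norm_rpow_eq_tsum two_toReal_pos f

theorem sum_norm_sq_le (f : EllTwo 𝕜) (s : Finset ℤ) : ∑ j ∈ s, ‖f j‖ ^ 2 ≤ ‖f‖ ^ 2 := by
  simpa using lp.sum_rpow_le_norm_rpow two_toReal_pos f s

/-- Translation on `ℓ²(ℤ)`. -/
noncomputable def translate (m : ℤ) (f : EllTwo 𝕜) : EllTwo 𝕜 :=
  ⟨fun j => f (j + m), memℓp_translate (lp.memℓp f) m⟩

theorem norm_translate (m : ℤ) (f : EllTwo 𝕜) : ‖translate m f‖ = ‖f‖ := by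
  refine (pow_left_inj₀ (norm_nonneg _) (norm_nonneg _) two_ne_zero).mp ?_
  rw [norm_sq_eq_tsum, norm_sq_eq_tsum]
  exact (Equiv.addRight m).tsum_eq fun j => ‖f j‖ ^ 2

theorem gradConv_eq_sum (u : Window n → ℝ) (f : EllTwo 𝕜) :
    gradConv u f =
      ∑ k : Window n, (u k : 𝕜) • (translate (1 - (k : ℤ)) f - translate (-(k : ℤ)) f) := by
  ext j
  rw [lp.coeFn_sum, Finset.sum_apply]
  change ∑ k : Window n, f (j + 1 - k) * (u k : 𝕜) - ∑ k : Window n, f (j - k) * (u k : 𝕜) = _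
  rw [← Finset.sum_sub_distrib]
  refine Finset.sum_congr rfl fun k _ => ?_
  change _ = (u k : 𝕜) * (f (j + (1 - k)) - f (j + -k))
  rw [add_sub_assoc, sub_eq_add_neg j]
  ring

theorem norm_gradConv_le (u : Window n → ℝ) (f : EllTwo 𝕜) :
    ‖gradConv u f‖ ≤ (∑ k, |u k| * 2) * ‖f‖ := by
  rw [gradConv_eq_sum, Finset.sum_mul]
  refine (norm_sum_le _ _).trans (Finset.sum_le_sum fun k _ => ?_)
  rw [norm_smul, RCLike.norm_ofReal, mul_assoc]
  refine mul_le_mul_of_nonneg_left ((norm_sub_le _ _).trans ?_) (abs_nonneg _)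
  rw [norm_translate, norm_translate, two_mul]

theorem bddAbove_ratios (u : Window n → ℝ) : BddAbove (ratios 𝕜 u) := by
  refine ⟨∑ k, |u k| * 2, ?_⟩
  rintro r ⟨f, hf, rfl⟩
  exact (div_le_iff₀ (norm_pos_iff.mpr hf)).mpr (norm_gradConv_le u f)

theorem norm_gradConv_le_sSup (u : Window n → ℝ) (f : EllTwo 𝕜) :
    ‖gradConv u f‖ ≤ sSup (ratios 𝕜 u) * ‖f‖ := by
  by_cases hf : f = 0
  · subst hf
    simpa using norm_gradConv_le u (0 : EllTwo 𝕜)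
  · exact (div_le_iff₀ (norm_pos_iff.mpr hf)).mp (le_csSup (bddAbove_ratios u) ⟨f, hf, rfl⟩)

/-- The sum of differences of consecutive translates telescopes. -/
theorem gradConv_of_const {u : Window n → ℝ} {c : ℝ} (hu : ∀ k, u k = c) (f : EllTwo 𝕜) :
    gradConv u f = (c : 𝕜) • (translate (n + 1) f - translate (-n) f) := by
  rw [gradConv_eq_sum]
  simp only [hu, ← Finset.smul_sum]
  congr 1
  rw [sum_window (n := n) fun k : ℤ => translate (1 - k) f - translate (-k) f]
  have := Finset.sum_range_sub' (fun i : ℕ => translate ((n : ℤ) + 1 - i) f) (2 * n + 1)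
  convert this using 3
  · ring_nf
  · push_cast
    ring_nf
  · simp
  · push_cast
    ring_nf

theorem sSup_ratios_le_of_const {u : Window n → ℝ} (hu : ∀ k, u k = 1 / (2 * (n : ℝ) + 1)) :
    sSup (ratios 𝕜 u) ≤ 2 / (2 * (n : ℝ) + 1) := by
  refine Real.sSup_le ?_ (by positivity)
  rintro r ⟨f, hf, rfl⟩
  rw [div_le_iff₀ (norm_pos_iff.mpr hf), gradConv_of_const hu, norm_smul, RCLike.norm_ofReal,
    abs_of_nonneg (by positivity)]
  have h := norm_sub_le (translate ((n : ℤ) + 1) f) (translate (-(n : ℤ)) f)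
  rw [norm_translate, norm_translate] at h
  calc 1 / (2 * (n : ℝ) + 1) * ‖translate ((n : ℤ) + 1) f - translate (-(n : ℤ)) f‖
      ≤ 1 / (2 * (n : ℝ) + 1) * (‖f‖ + ‖f‖) := by gcongr
    _ = 2 / (2 * (n : ℝ) + 1) * ‖f‖ := by ring

/-! ### Test functions: truncated cosines -/

/-- The cosine wave of frequency `x` and phase `φ`, truncated to `{0, …, L - 1}`. -/
noncomputable def wave (x φ : ℝ) (L : ℕ) (j : ℤ) : ℝ :=
  if j ∈ Finset.Ico (0 : ℤ) L then Real.cos (j * x + φ) else 0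

theorem memℓp_wave (x φ : ℝ) (L : ℕ) : Memℓp (fun j => (wave x φ L j : 𝕜)) 2 := by
  rw [memℓp_gen_iff two_toReal_pos]
  refine summable_of_ne_finset_zero (s := Finset.Ico (0 : ℤ) L) fun j hj => ?_
  rw [wave, if_neg hj]
  simp

/-- The truncated cosine wave as an element of `ℓ²(ℤ)`. -/
noncomputable def waveEll (𝕜 : Type*) [RCLike 𝕜] (x φ : ℝ) (L : ℕ) : EllTwo 𝕜 :=
  ⟨fun j => (wave x φ L j : 𝕜), memℓp_wave x φ L⟩

theorem norm_waveEll_sq (x φ : ℝ) (L : ℕ) :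
    ‖waveEll 𝕜 x φ L‖ ^ 2 = ∑ j ∈ Finset.Ico (0 : ℤ) L, Real.cos (j * x + φ) ^ 2 := by
  have hcoe : ∀ j, ‖waveEll 𝕜 x φ L j‖ ^ 2 = wave x φ L j ^ 2 := fun j => by
    change ‖(wave x φ L j : 𝕜)‖ ^ 2 = _
    rw [RCLike.norm_ofReal, sq_abs]
  rw [norm_sq_eq_tsum, tsum_eq_sum (s := Finset.Ico (0 : ℤ) L)]
  · refine Finset.sum_congr rfl fun j hj => ?_
    rw [hcoe, wave, if_pos hj]
  · intro j hj
    rw [hcoe, wave, if_neg hj]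
    simp

theorem conv_waveEll {u : Window n → ℝ} (hu : IsSymmetric u) (x φ : ℝ) {L : ℕ} {j : ℤ}
    (hj : (n : ℤ) ≤ j) (hj' : j < L - n) :
    conv (waveEll 𝕜 x φ L : ℤ → 𝕜) u j = ((symbol u x * Real.cos (j * x + φ) : ℝ) : 𝕜) := by
  rw [← sum_cos_sub_mul hu]
  change ∑ k : Window n, (wave x φ L (j - k) : 𝕜) * (u k : 𝕜) = _
  push_cast
  refine Finset.sum_congr rfl fun k _ => ?_
  have hk := Finset.mem_Icc.mp k.2
  rw [wave, if_pos (by rw [Finset.mem_Ico]; omega)]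
  push_cast
  ring_nf

theorem norm_gradConv_waveEll_sq {u : Window n → ℝ} (hu : IsSymmetric u) (x φ : ℝ) {L : ℕ} {j : ℤ}
    (hj : (n : ℤ) ≤ j) (hj' : j < L - n - 1) :
    ‖gradConv u (waveEll 𝕜 x φ L) j‖ ^ 2 =
      (2 * Real.sin (x / 2) * symbol u x) ^ 2 * Real.sin (j * x + x / 2 + φ) ^ 2 := by
  have h : gradConv u (waveEll 𝕜 x φ L) j =
      ((symbol u x * (Real.cos ((j + 1 : ℤ) * x + φ) - Real.cos (j * x + φ)) : ℝ) : 𝕜) := by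
    change conv (waveEll 𝕜 x φ L : ℤ → 𝕜) u (j + 1) - conv (waveEll 𝕜 x φ L : ℤ → 𝕜) u j = _
    rw [conv_waveEll hu x φ (by omega) (by omega), conv_waveEll hu x φ hj (by omega)]
    push_cast
    ring
  rw [h, RCLike.norm_ofReal, sq_abs, Real.cos_sub_cos]
  have h1 : (((j + 1 : ℤ) : ℝ) * x + φ + (j * x + φ)) / 2 = j * x + x / 2 + φ := by
    push_cast; ring
  have h2 : (((j + 1 : ℤ) : ℝ) * x + φ - (j * x + φ)) / 2 = x / 2 := by
    push_cast; ring
  rw [h1, h2]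
  ring

/-- Adding the estimates for phases 0 and `π/2` turns `sin² + cos²` into 1, so both energies become
point counts. -/
theorem symbol_sq_mul_le {u : Window n → ℝ} (hu : IsSymmetric u) (x : ℝ) (M : ℕ) :
    (2 * Real.sin (x / 2) * symbol u x) ^ 2 * M ≤
      sSup (ratios 𝕜 u) ^ 2 * (M + (2 * n + 1)) := by
  set A := 2 * Real.sin (x / 2) * symbol u x with hA
  -- Truncation spoils `n` points on the left and `n + 1` on the right, leaving `M`.
  set L : ℕ := M + (2 * n + 1) with hL
  have hphase : ∀ φ, A ^ 2 * ∑ j ∈ Finset.Ico (n : ℤ) (n + M), Real.sin (j * x + x / 2 + φ) ^ 2 ≤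
      sSup (ratios 𝕜 u) ^ 2 * ∑ j ∈ Finset.Ico (0 : ℤ) L, Real.cos (j * x + φ) ^ 2 := by
    intro φ
    rw [← norm_waveEll_sq (𝕜 := 𝕜), ← mul_pow, Finset.mul_sum]
    calc ∑ j ∈ Finset.Ico (n : ℤ) (n + M), A ^ 2 * Real.sin (j * x + x / 2 + φ) ^ 2
        = ∑ j ∈ Finset.Ico (n : ℤ) (n + M), ‖gradConv u (waveEll 𝕜 x φ L) j‖ ^ 2 := by
          refine Finset.sum_congr rfl fun j hj => ?_
          rw [Finset.mem_Ico] at hj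
          rw [norm_gradConv_waveEll_sq hu x φ hj.1 (by push_cast [hL]; omega)]
      _ ≤ ‖gradConv u (waveEll 𝕜 x φ L)‖ ^ 2 := sum_norm_sq_le _ _
      _ ≤ (sSup (ratios 𝕜 u) * ‖waveEll 𝕜 x φ L‖) ^ 2 :=
          pow_le_pow_left₀ (norm_nonneg _) (norm_gradConv_le_sSup u _) 2
  have h := add_le_add (hphase 0) (hphase (Real.pi / 2))
  rw [← mul_add, ← mul_add, ← Finset.sum_add_distrib, ← Finset.sum_add_distrib] at h
  simp only [add_zero, Real.sin_add_pi_div_two, Real.cos_add_pi_div_two, neg_sq,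
    Real.sin_sq_add_cos_sq, Real.cos_sq_add_sin_sq, Finset.sum_const, Int.card_Ico, nsmul_eq_mul,
    mul_one, add_sub_cancel_left, sub_zero, Int.toNat_natCast] at h
  simpa [hL] using h

theorem abs_symbol_le_sSup {u : Window n → ℝ} (hu : IsSymmetric u) (x : ℝ) :
    |2 * Real.sin (x / 2) * symbol u x| ≤ sSup (ratios 𝕜 u) := by
  have hS : 0 ≤ sSup (ratios 𝕜 u) := by
    refine Real.sSup_nonneg ?_
    rintro r ⟨f, -, rfl⟩
    positivity
  refine abs_le_of_sq_le_sq ?_ hS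
  by_contra! hlt
  -- For large `M` the boundary term `2n + 1` is negligible.
  obtain ⟨M, hM⟩ := exists_nat_gt (sSup (ratios 𝕜 u) ^ 2 * (2 * n + 1) /
    ((2 * Real.sin (x / 2) * symbol u x) ^ 2 - sSup (ratios 𝕜 u) ^ 2))
  rw [div_lt_iff₀ (sub_pos.mpr hlt)] at hM
  have := symbol_sq_mul_le (𝕜 := 𝕜) hu x M
  linarith

end Operator

end SmoothAveraging

theorem theorem1 (𝕜 : Type*) [RCLike 𝕜] (n : ℕ) (u : SmoothAveraging.Window n → ℝ)
    (hsymm : SmoothAveraging.IsSymmetric u) (hsum : ∑ k, u k = 1) :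
    BddAbove (SmoothAveraging.ratios 𝕜 u) ∧
    2 / (2 * (n : ℝ) + 1) ≤ sSup (SmoothAveraging.ratios 𝕜 u) ∧
    (sSup (SmoothAveraging.ratios 𝕜 u) = 2 / (2 * (n : ℝ) + 1) ↔
      ∀ k, u k = 1 / (2 * (n : ℝ) + 1)) := by
  open SmoothAveraging in
  have hconst : sSup (ratios 𝕜 u) ≤ 2 / (2 * (n : ℝ) + 1) →
      ∀ k, u k = 1 / (2 * (n : ℝ) + 1) := fun h =>
    eq_const_of_symbol_le hsymm hsum fun x => (abs_symbol_le_sSup hsymm x).trans h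
  have hlower : 2 / (2 * (n : ℝ) + 1) ≤ sSup (ratios 𝕜 u) := by
    by_contra! hlt
    have hu := hconst hlt.le
    have hN : (0 : ℝ) < 2 * n + 1 := by positivity
    -- At this frequency `(2n+1)x/2 = π/2`, so the constant kernel attains `2/(2n+1)`.
    have h := abs_symbol_le_sSup (𝕜 := 𝕜) hsymm (Real.pi / (2 * n + 1))
    have hs : 2 * Real.sin (Real.pi / (2 * n + 1) / 2) * symbol u (Real.pi / (2 * n + 1)) =
        2 / (2 * (n : ℝ) + 1) := by
      have hd := two_sin_half_mul_sum_cos (n := n) (Real.pi / (2 * n + 1))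
      rw [mul_div_cancel₀ _ hN.ne', Real.sin_pi_div_two] at hd
      simp only [symbol, hu, ← Finset.mul_sum]
      linear_combination (1 / (2 * (n : ℝ) + 1)) * hd
    rw [hs] at h
    linarith [le_abs_self (2 / (2 * (n : ℝ) + 1))]
  exact ⟨bddAbove_ratios u, hlower, fun h => hconst h.le,
    fun h => le_antisymm (sSup_ratios_le_of_const h) hlower⟩
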